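/- Let $G$ be a finite undirected loopless graph (multiple edges allowed) with nonnegative real edge weights $\mathbf w=\{w_f\}_{f\in E(G)}$. For a vertex set $S\subseteq V(G)$ let $\delta_G(S)$ be the set of edges of $G$ between $S$ and $V(G)\setminus S$. For distinct vertices $x,y$ let $$\lambda_G(x,y;\mathbf w)=\min_{S\subseteq V(G),\ x\in S,\ y\notin S}\ \sum_{f\in\delta_G(S)}w_f$$ be the maximum flow from $x$ to $y$ with edge capacities $\mathbf w$ (equal to the minimum weight of a cut between $x$ and $y$), and let $\Lambda(G,\mathbf w)=\max_{x\ne y}\lambda_G(x,y;\mathbf w)$ be the maxmaxflow of $(G,\mathbf w)$. The weight of a subgraph $H$ is $w(H)=\prod_{f\in E(H)}w_f$. A graph is called 2-connected if it is connected, has no cut vertex, and has at least two edges (so $K_1$ and $K_2$ are excluded, while two vertices joined by at least two parallel edges are allowed). Fix an edge $e\in E(G)$, let $G-e$ be $G$ with the edge $e$ deleted, and let $b_m(e)$ be the sum of the weights $w(H)$ of the 2-connected $m$-edge subgraphs $H$ of $G$ containing $e$. Then $$\sum_{m=0}^\infty\left(\frac{2\Lambda(G-e,\mathbf w)}{\ln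 2}\right)^{1-m}b_m(e)\ \le\ w_e .$$ In particular, if $w_e\le 2\Lambda(G-e,\mathbf w)/\ln 2$, then $$\sum_{m=0}^\infty\left(\frac{2\Lambda(G-e,\mathbf w)}{\ln 2}\right)^{-m}b_m(e)\ \le\ 1 .$$ If $\Lambda(G-e,\mathbf w)=0$, these sums are read in $[0,\infty]$ with $0^{-k}=+\infty$ for $k\ge1$, $0^0=1$ and $\infty\cdot0=0$. -/

import Mathlib

open scoped Graph NNReal ENNReal

noncomputable section

namespace Graph

variable {α β : Type*}

/-- `x` and `y` lie in the same connected component of the multigraph `G`. -/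
def SameComponent (G : Graph α β) (x y : α) : Prop :=
  x ∈ V(G) ∧ y ∈ V(G) ∧ Relation.ReflTransGen G.Adj x y

/-- `G` is connected: it is nonempty and any two of its vertices are joined by a walk. -/
def IsConnectedGraph (G : Graph α β) : Prop :=
  V(G).Nonempty ∧ ∀ x ∈ V(G), ∀ y ∈ V(G), G.SameComponent x y

/-- `x` is a cut vertex of `G`: deleting `x` increases the number of components, that is,
some component of `G` containing `x` falls apart into at least two pieces. -/
def IsCutVertex (G : Graph α β) (x : α) : Prop :=
  x ∈ V(G) ∧ ∃ u ∈ V(G) \ {x}, ∃ v ∈ V(G) \ {x},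
    G.SameComponent u v ∧ ¬ (G.deleteVerts {x}).SameComponent u v

/-- `G` is non-separable: it is connected and has no cut vertex. -/
def IsNonseparable (G : Graph α β) : Prop :=
  G.IsConnectedGraph ∧ ∀ x, ¬ G.IsCutVertex x

/-- A loopless multigraph is 2-connected if it is non-separable and is neither a single vertex
nor a single edge with its two ends (`K₁` or `K₂`), i.e. it has at least two edges. -/
def IsTwoConnected (G : Graph α β) : Prop :=
  G.IsNonseparable ∧ E(G).Nontrivial

/-- The edges of `G` between `S` and its complement. -/
def cutEdges (G : Graph α β) (S : Set α) : Set β :=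
  {f | ∃ u ∈ S, ∃ v ∉ S, G.IsLink f u v}

/-- The total weight of the edges of `G` between `S` and its complement. -/
def cutWeight (G : Graph α β) (w : β → ℝ≥0) (S : Set α) : ℝ≥0∞ :=
  ∑' f : G.cutEdges S, (w f : ℝ≥0∞)

/-- The maximum flow `λ_G(x, y; w)` from `x` to `y` with edge capacities `w`, as the minimum
weight of a cut between `x` and `y`. -/
def maxFlow (G : Graph α β) (w : β → ℝ≥0) (x y : α) : ℝ≥0∞ :=
  ⨅ S : {S : Set α // S ⊆ V(G) ∧ x ∈ S ∧ y ∉ S}, G.cutWeight w S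

/-- The maxmaxflow `Λ(G, w)`: the maximum of `λ_G(x, y; w)` over pairs of distinct vertices. -/
def maxmaxflow (G : Graph α β) (w : β → ℝ≥0) : ℝ≥0∞ :=
  ⨆ x ∈ V(G), ⨆ y ∈ V(G), ⨆ _ : x ≠ y, G.maxFlow w x y

/-- The weight of a finite graph: the product of its edge weights. -/
def weight (H : Graph α β) (w : β → ℝ≥0) : ℝ≥0 :=
  ∏ᶠ f ∈ E(H), w f

/-- `b_m(e)`: the sum of the weights of the 2-connected `m`-edge subgraphs of `G`
containing the edge `e`. -/
def twoConnectedSum (G : Graph α β) (w : β → ℝ≥0) (e : β) (m : ℕ) : ℝ≥0∞ :=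
  ∑' H : {H : Graph α β // H ≤ G ∧ H.IsTwoConnected ∧ e ∈ E(H) ∧ E(H).encard = m},
    (H.1.weight w : ℝ≥0∞)

end Graph

end

/-! ### Block paths and the recursive cutting bound. -/

namespace Graph

/-! Let `e` join `x` and `y`, and put `p f = w f / t` with `t = 2Λ(G - e) / log 2`. An `m`-edge `H`
containing `e` contributes `w e * ∏ p f` over its other edges, which form a block path from `x` to
`y` (`IsTwoConnected.isBlockPath`). So it suffices that all block paths have total `p`-weight at
most 1 (`sum_isBlockPath_le_one`).

Explore a block path by successive cuts. The label of a vertex records its sides of the cuts so far,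
and the path edges crossing some cut are the known ones. While two terminals of the known part share
a label, separate them by a minimum cut. Giving each edge weight `2 * p f`, the possible choices of
newly known edges total at most `∏ (1 + 2 * p f) ≤ 2` over that cut (`exists_cut_prod_le_two`),
while the terminals gain a label, worth a factor 1/2. Once labels are distinct on terminals, the
whole path is known, since unknown edges would join two terminals with equal labels. The path has at
most one more terminal than edges, so the 2's on the edges pay for all the 1/2's but one, and that
one is the initial label (`sum_filter_crosses_le`). -/

/-- The set consisting of `x`, `y` and the ends of the edges in `D`. -/
def terminals {α β : Type*} (G : Graph α β) (x y : α) (D : Finset β) : Set α :=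
  {v | v = x ∨ v = y ∨ ∃ f ∈ D, G.Inc f v}

/-- An edge set of `G` that joins `x` and `y` through a chain of blocks: it is no smaller than a
tree on its terminals, and whatever proper part of it is known, the rest joins two distinct
terminals of that part. -/
structure IsBlockPath {α β : Type*} (G : Graph α β) (x y : α) (H : Finset β) : Prop where
  ncard_le : (G.terminals x y H).ncard ≤ H.card + 1
  exists_joined : ∀ D ⊂ H, ∃ u ∈ G.terminals x y D, ∃ v ∈ G.terminals x y D, u ≠ v ∧
    Relation.ReflTransGen (fun a b => ∃ f ∈ H, f ∉ D ∧ G.IsLink f a b) u v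

/-- The edge `f` has ends with different labels. -/
def Crosses {α β τ : Type*} (G : Graph α β) (φ : α → τ) (f : β) : Prop :=
  ∃ u v, G.IsLink f u v ∧ φ u ≠ φ v

variable {α β : Type*} {G : Graph α β} {x y : α}

lemma terminals_mono {D D' : Finset β} (h : D ⊆ D') :
    G.terminals x y D ⊆ G.terminals x y D' := by
  rintro v (hv | hv | ⟨f, hf, hv⟩)
  · exact Or.inl hv
  · exact Or.inr (Or.inl hv)
  · exact Or.inr (Or.inr ⟨f, h hf, hv⟩)

lemma terminals_subset (hx : x ∈ V(G)) (hy : y ∈ V(G)) (D : Finset β) :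
    G.terminals x y D ⊆ V(G) := by
  rintro v (rfl | rfl | ⟨f, hf, hv⟩)
  · exact hx
  · exact hy
  · exact hv.vertex_mem

lemma IsLink.crosses_iff {τ : Type*} {φ : α → τ} {f : β} {u v : α} (h : G.IsLink f u v) :
    G.Crosses φ f ↔ φ u ≠ φ v := by
  refine ⟨?_, fun hne => ⟨u, v, h, hne⟩⟩
  rintro ⟨a, b, hab, hne⟩
  rcases h.eq_and_eq_or_eq_and_eq hab with ⟨rfl, rfl⟩ | ⟨rfl, rfl⟩
  · exact hne
  · exact hne.symm

lemma Crosses.cons {φ : α → List Prop} {f : β} (h : G.Crosses φ f) (S : Set α) :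
    G.Crosses (fun a => (a ∈ S) :: φ a) f := by
  obtain ⟨u, v, huv, hne⟩ := h
  exact ⟨u, v, huv, fun h => hne (List.cons.inj h).2⟩

lemma Crosses.mem_cutEdges {φ : α → List Prop} {f : β} {S : Set α}
    (h : G.Crosses (fun a => (a ∈ S) :: φ a) f) (h' : ¬ G.Crosses φ f) : f ∈ G.cutEdges S := by
  obtain ⟨u, v, huv, hne⟩ := h
  rw [huv.crosses_iff, not_not] at h'
  simp only [h', ne_eq, List.cons.injEq, and_true, eq_iff_iff] at hne
  by_cases hu : u ∈ S
  · exact ⟨u, hu, v, by tauto, huv⟩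
  · exact ⟨v, by tauto, u, hu, huv.symm⟩

/-- Refining a labelling so as to separate two elements of `U` yields more labels on `U`. -/
lemma ncard_image_lt_of_separates {φ : α → List Prop} {S U : Set α} (hU : U.Finite) {u v : α}
    (hu : u ∈ U) (hv : v ∈ U) (hφ : φ u = φ v) (huS : u ∈ S) (hvS : v ∉ S) :
    (φ '' U).ncard < ((fun a => (a ∈ S) :: φ a) '' U).ncard := by
  set ψ : α → List Prop := fun a => (a ∈ S) :: φ a with hψ
  -- Forgetting the newest cut maps the new labels onto the old ones and merges those of `u` and
  -- `v`.
  have himg : φ '' U = List.tail '' (ψ '' U) := by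
    rw [Set.image_image]; rfl
  have hfin : (ψ '' U).Finite := hU.image _
  refine lt_of_le_of_ne (himg ▸ Set.ncard_image_le hfin) fun heq => ?_
  rw [himg, Set.ncard_image_iff hfin] at heq
  have := heq (Set.mem_image_of_mem ψ hu) (Set.mem_image_of_mem ψ hv) hφ
  simp only [hψ, List.cons.injEq, eq_iff_iff] at this
  exact hvS (this.1.1 huS)

open Classical Finset in
/-- Weighted count of the block paths whose edges crossing `φ` form the set `D`. -/
lemma sum_filter_crosses_le (hV : V(G).Finite) (hx : x ∈ V(G)) (hy : y ∈ V(G)) (E : Finset β)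
    (p : β → ℝ≥0)
    (hcut : ∀ u ∈ V(G), ∀ v ∈ V(G), u ≠ v → ∃ S : Set α, u ∈ S ∧ v ∉ S ∧
      ∏ f ∈ E with f ∈ G.cutEdges S, (1 + 2 * p f) ≤ 2)
    (n : ℕ) (φ : α → List Prop) (D : Finset β)
    (hn : V(G).ncard - (φ '' G.terminals x y D).ncard = n) :
    ∑ H ∈ E.powerset with G.IsBlockPath x y H ∧ H.filter (G.Crosses φ) = D,
      (∏ f ∈ H \ D, 2 * p f) * (1 / 2) ^ (G.terminals x y H).ncard
      ≤ (1 / 2 : ℝ≥0) ^ (φ '' G.terminals x y D).ncard := by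
  have hUfin : ∀ D, (G.terminals x y D).Finite := fun D => hV.subset (terminals_subset hx hy D)
  induction n using Nat.strong_induction_on generalizing φ D with
  | _ n ih =>
  by_cases hinj : Set.InjOn φ (G.terminals x y D)
  -- Edges outside `D` preserve `φ`, so a proper `D` would join two distinct terminals with the same
  -- label. Only `H = D` survives.
  · have hsub : (E.powerset.filter fun H => G.IsBlockPath x y H ∧ H.filter (G.Crosses φ) = D)
        ⊆ {D} := by
      intro H hH
      obtain ⟨-, hH, hD⟩ := by simpa only [Finset.mem_filter] using hH
      rw [Finset.mem_singleton]
      by_contra hne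
      have hDH : D ⊂ H := (hD ▸ Finset.filter_subset _ _ : D ⊆ H).ssubset_of_ne (Ne.symm hne)
      obtain ⟨u, hu, v, hv, huv, hreach⟩ := hH.exists_joined D hDH
      refine huv (hinj hu hv ?_)
      clear hv huv
      induction hreach with
      | refl => rfl
      | tail _ hlast ih' =>
        obtain ⟨f, hfH, hfD, hl⟩ := hlast
        rw [ih']
        by_contra hne'
        exact hfD (hD ▸ Finset.mem_filter.2 ⟨hfH, hl.crosses_iff.2 hne'⟩)
    refine (Finset.sum_le_sum_of_subset hsub).trans ?_
    simp [hinj.ncard_image]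
  · simp only [Set.InjOn, not_forall] at hinj
    obtain ⟨u, hu, v, hv, hφ, huv⟩ := hinj
    obtain ⟨S, huS, hvS, hprod⟩ :=
      hcut u (terminals_subset hx hy D hu) v (terminals_subset hx hy D hv) huv
    set ψ : α → List Prop := fun a => (a ∈ S) :: φ a with hψ
    set N : Finset β := E.filter fun f => G.Crosses ψ f ∧ ¬ G.Crosses φ f with hN
    have hcard : ∀ A : Finset β,
        (φ '' G.terminals x y D).ncard + 1 ≤ (ψ '' G.terminals x y (D ∪ A)).ncard := fun A =>
      (Nat.succ_le_of_lt (ncard_image_lt_of_separates (hUfin D) hu hv hφ huS hvS)).trans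
        (Set.ncard_le_ncard (Set.image_mono (terminals_mono Finset.subset_union_left))
          ((hUfin _).image _))
    have hcardV : ∀ A : Finset β, (ψ '' G.terminals x y (D ∪ A)).ncard ≤ V(G).ncard := fun A =>
      (Set.ncard_image_le (hUfin _)).trans
        (Set.ncard_le_ncard (terminals_subset hx hy _) hV)
    have hNsub : N ⊆ E.filter (· ∈ G.cutEdges S) := fun f hf => by
      simp only [hN, Finset.mem_filter] at hf ⊢
      exact ⟨hf.1, hf.2.1.mem_cutEdges hf.2.2⟩
    -- Split by the set `A` of edges of `H` that the new cut reveals.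
    rw [← Finset.sum_fiberwise_of_maps_to (t := N.powerset)
      (g := fun H => H.filter fun f => G.Crosses ψ f ∧ ¬ G.Crosses φ f)
      (fun H hH => by
        simp only [Finset.mem_filter, Finset.mem_powerset] at hH ⊢
        exact Finset.filter_subset_filter _ hH.1)]
    have hfib : ∀ A ∈ N.powerset,
        ∑ H ∈ (E.powerset.filter fun H => G.IsBlockPath x y H ∧ H.filter (G.Crosses φ) = D) with
          (H.filter fun f => G.Crosses ψ f ∧ ¬ G.Crosses φ f) = A,
          (∏ f ∈ H \ D, 2 * p f) * (1 / 2) ^ (G.terminals x y H).ncard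
        ≤ (∏ f ∈ A, 2 * p f) * (1 / 2) ^ ((φ '' G.terminals x y D).ncard + 1) := by
      intro A hA
      have hstep := ih _ (by have := hcard A; have := hcardV A; omega) ψ (D ∪ A) rfl
      calc _ ≤ ∑ H ∈ E.powerset with G.IsBlockPath x y H ∧ H.filter (G.Crosses ψ) = D ∪ A,
              (∏ f ∈ A, 2 * p f) * ((∏ f ∈ H \ (D ∪ A), 2 * p f) *
                (1 / 2) ^ (G.terminals x y H).ncard) := by
            refine (Finset.sum_congr rfl fun H hH => ?_).trans_le
              (Finset.sum_le_sum_of_subset fun H hH => ?_)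
            · simp only [Finset.mem_filter, Finset.mem_powerset] at hH
              obtain ⟨⟨-, -, hD⟩, hA'⟩ := hH
              rw [← mul_assoc, ← Finset.prod_union]
              · congr 2
                subst hD hA'
                ext f
                simp only [Finset.mem_sdiff, Finset.mem_filter, Finset.mem_union]
                tauto
              · exact Finset.disjoint_left.2 fun f hf hf' =>
                  (Finset.mem_sdiff.1 hf').2 (Finset.mem_union_right _ hf)
            · simp only [Finset.mem_filter, Finset.mem_powerset] at hH ⊢
              obtain ⟨⟨hHE, hH, hD⟩, hA'⟩ := hH
              refine ⟨hHE, hH, ?_⟩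
              subst hD hA'
              ext f
              have : G.Crosses φ f → G.Crosses ψ f := fun h => h.cons S
              simp only [Finset.mem_filter, Finset.mem_union]
              tauto
        _ ≤ (∏ f ∈ A, 2 * p f) * (1 / 2) ^ (ψ '' G.terminals x y (D ∪ A)).ncard := by
            rw [← Finset.mul_sum]
            gcongr
        _ ≤ _ := by
            exact mul_le_mul_right (pow_le_pow_of_le_one (by positivity)
              (half_le_self zero_le_one) (hcard A)) _
    refine (Finset.sum_le_sum hfib).trans ?_
    -- Summing over all `A ⊆ N` gives a product over `N`, whose bound 2 cancels the factor 1/2 from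
    -- the extra label.
    rw [← Finset.sum_mul, ← Finset.prod_one_add]
    calc (∏ f ∈ N, (1 + 2 * p f)) * (1 / 2) ^ ((φ '' G.terminals x y D).ncard + 1)
        ≤ 2 * (1 / 2) ^ ((φ '' G.terminals x y D).ncard + 1) := by
          gcongr
          exact (Finset.prod_le_prod_of_subset_of_one_le' hNsub
            fun f _ _ => le_add_of_nonneg_right (by positivity)).trans hprod
      _ = _ := by
          rw [pow_succ, mul_comm, mul_assoc, one_div, inv_mul_cancel₀ two_ne_zero, mul_one]

open Classical Finset in
/-- If any two vertices are separated by a light cut, then the block paths joining `x` and `y`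
have total weight at most one. -/
theorem sum_isBlockPath_le_one (hV : V(G).Finite) (hx : x ∈ V(G)) (hy : y ∈ V(G)) (E : Finset β)
    (p : β → ℝ≥0)
    (hcut : ∀ u ∈ V(G), ∀ v ∈ V(G), u ≠ v → ∃ S : Set α, u ∈ S ∧ v ∉ S ∧
      ∏ f ∈ E with f ∈ G.cutEdges S, (1 + 2 * p f) ≤ 2) :
    ∑ H ∈ E.powerset with G.IsBlockPath x y H, ∏ f ∈ H, p f ≤ 1 := by
  have h := sum_filter_crosses_le hV hx hy E p hcut _ (fun _ => []) ∅ rfl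
  have himg : ((fun _ => []) '' G.terminals x y ∅ : Set (List Prop)) = {[]} :=
    Set.Nonempty.image_const ⟨x, Or.inl rfl⟩ _
  have hno : ∀ H : Finset β, H.filter (G.Crosses fun _ => ([] : List Prop)) = ∅ := fun H => by
    simp [Crosses]
  simp only [himg, hno, and_true, Finset.sdiff_empty, Set.ncard_singleton, pow_one] at h
  have h2 : (1 / 2 : ℝ≥0) * ∑ H ∈ E.powerset with G.IsBlockPath x y H, ∏ f ∈ H, p f ≤ 1 / 2 := by
    refine le_trans ?_ h
    rw [Finset.mul_sum]
    refine Finset.sum_le_sum fun H hH => ?_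
    rw [Finset.prod_mul_distrib, Finset.prod_const, mul_right_comm]
    gcongr
    calc (1 / 2 : ℝ≥0) = 2 ^ H.card * (1 / 2) ^ (H.card + 1) := by
          rw [pow_succ, ← mul_assoc, ← mul_pow]; norm_num
      _ ≤ _ := by
          exact mul_le_mul_right (pow_le_pow_of_le_one (by positivity)
            (half_le_self zero_le_one)
            (Finset.mem_filter.1 hH).2.ncard_le) _
  have := mul_le_mul_of_nonneg_left h2 (zero_le_two (α := ℝ≥0))
  rwa [← mul_assoc, mul_one_div_cancel two_ne_zero, one_mul] at this

end Graph

/-! ### From 2-connected subgraphs to block paths. -/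

namespace Graph

variable {α β : Type*} {G : Graph α β} {x y : α}

/-- The edges in `D` reach at most `#D + 1` vertices from `x`. -/
lemma ncard_le_of_reachable (D : Finset β) (W : Set α)
    (hW : ∀ v ∈ W, Relation.ReflTransGen (fun a b => ∃ f ∈ D, G.IsLink f a b) x v) :
    W.ncard ≤ D.card + 1 := by
  classical
  set Q : Finset β → Prop := fun C =>
    (G.terminals x x C).Finite ∧ (G.terminals x x C).ncard ≤ C.card + 1 with hQ
  have h0 : Q ∅ := by
    have : G.terminals x x (∅ : Finset β) = {x} := by ext v; simp [terminals]
    simp [hQ, this]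
  -- If a maximal `C` missed a vertex of `W`, some edge of `D` would leave its terminals, and adding
  -- it would cost one edge and at most one vertex.
  obtain ⟨C, hC, hmax⟩ := Finset.exists_max_image (D.powerset.filter Q) Finset.card
    ⟨∅, by simpa using h0⟩
  simp only [Finset.mem_filter, Finset.mem_powerset] at hC hmax
  obtain ⟨hCD, hfin, hcard⟩ := hC
  have hsub : W ⊆ G.terminals x x C := by
    intro v hv
    replace hv := hW v hv
    induction hv with
    | refl => exact Or.inl rfl
    | @tail b c _ hbc ih =>
      obtain ⟨f, hfD, hf⟩ := hbc
      by_contra hc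
      have hfC : f ∉ C := fun hfC => hc (Or.inr (Or.inr ⟨f, hfC, hf.inc_right⟩))
      have heq : G.terminals x x (insert f C) ⊆ insert c (G.terminals x x C) := by
        rintro v (hv | hv | ⟨g, hg, hv⟩)
        · exact Or.inr (Or.inl hv)
        · exact Or.inr (Or.inl hv)
        · rcases Finset.mem_insert.1 hg with rfl | hg
          · rcases hv.eq_or_eq_of_isLink hf with rfl | rfl
            · exact Or.inr ih
            · exact Or.inl rfl
          · exact Or.inr (Or.inr (Or.inr ⟨g, hg, hv⟩))
      have h1 := hmax (insert f C) ⟨Finset.insert_subset hfD hCD, (hfin.insert c).subset heq, by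
        rw [Finset.card_insert_of_notMem hfC]
        have := Set.ncard_le_ncard heq (hfin.insert c)
        have := Set.ncard_insert_le c (G.terminals x x C)
        omega⟩
      rw [Finset.card_insert_of_notMem hfC] at h1
      omega
  exact ((Set.ncard_le_ncard hsub hfin).trans hcard).trans
    (Nat.succ_le_succ (Finset.card_le_card hCD))

/-- Deleting an edge `e` from a 2-connected graph leaves a block path between the ends of `e`. -/
theorem IsTwoConnected.isBlockPath {H : Graph α β} (hH : H.IsTwoConnected) (hHG : H ≤ G)
    [G.Loopless] {e : β} (he : H.IsLink e x y) {D₀ : Finset β} (hD₀ : (D₀ : Set β) = E(H) \ {e}) :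
    (G.deleteEdges {e}).IsBlockPath x y D₀ := by
  have hmem : ∀ f, f ∈ D₀ ↔ f ∈ E(H) ∧ f ≠ e := fun f => by
    rw [← Finset.mem_coe, hD₀]; simp
  have hlink : ∀ {f}, f ∈ D₀ → ∀ {a b}, (G.deleteEdges {e}).IsLink f a b ↔ H.IsLink f a b := by
    intro f hf a b
    rw [hHG.isLink_iff ((hmem f).1 hf).1, deleteEdges_isLink]
    simp [((hmem f).1 hf).2]
  have hne : ∀ {f a b}, H.IsLink f a b → a ≠ b := fun h => (h.mono hHG).ne
  have hsymm : ∀ D : Finset β, ∀ {u v}, Relation.ReflTransGen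
      (fun a b => ∃ f ∈ D₀, f ∉ D ∧ (G.deleteEdges {e}).IsLink f a b) u v →
      Relation.ReflTransGen
      (fun a b => ∃ f ∈ D₀, f ∉ D ∧ (G.deleteEdges {e}).IsLink f a b) v u := fun D u v h =>
    Relation.ReflTransGen.mono (fun a b ⟨f, h1, h2, h3⟩ => ⟨f, h1, h2, h3.symm⟩) _ _ h.swap
  have hjoin : ∀ D ⊂ D₀, ∃ u ∈ (G.deleteEdges {e}).terminals x y D,
      ∃ v ∈ (G.deleteEdges {e}).terminals x y D, u ≠ v ∧
      Relation.ReflTransGen (fun a b => ∃ f ∈ D₀, f ∉ D ∧ (G.deleteEdges {e}).IsLink f a b)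
        u v := by
    intro D hD
    by_contra hcon
    set R := Relation.ReflTransGen
      (fun a b => ∃ f ∈ D₀, f ∉ D ∧ (G.deleteEdges {e}).IsLink f a b) with hR
    obtain ⟨f, hf, hfD⟩ := Finset.exists_of_ssubset hD
    obtain ⟨a, b, hab⟩ := H.exists_isLink_of_mem_edgeSet ((hmem f).1 hf).1
    set U := (G.deleteEdges {e}).terminals x y D with hU
    -- The `R`-class of `a` has at most one terminal and can be left only there. That terminal is
    -- then a cut vertex separating `c` inside from `z` outside; with no terminal, `H` is
    -- disconnected.
    have huniq : ∀ u ∈ U, ∀ v ∈ U, R a u → R a v → u = v := fun u hu v hv hau hav =>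
      by_contra fun huv => hcon ⟨u, hu, v, hv, huv, (hsymm D hau).trans hav⟩
    have hRb : R a b := .single ⟨f, hf, hfD, (hlink hf).2 hab⟩
    obtain ⟨c, hcV, hac, hcU⟩ : ∃ c ∈ V(H), R a c ∧ c ∉ U := by
      by_cases haU : a ∈ U
      · exact ⟨b, hab.right_mem, hRb, fun hbU => hne hab (huniq a haU b hbU .refl hRb)⟩
      · exact ⟨a, hab.left_mem, .refl, haU⟩
    obtain ⟨z, hzV, hzU, hz⟩ : ∃ z ∈ V(H), z ∈ U ∧ ¬ R a z := by
      by_cases hax : R a x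
      · exact ⟨y, he.right_mem, Or.inr (Or.inl rfl), fun hay =>
          hne he (huniq x (Or.inl rfl) y (Or.inr (Or.inl rfl)) hax hay)⟩
      · exact ⟨x, he.left_mem, Or.inl rfl, hax⟩
    have hout : ∀ g u v, H.IsLink g u v → R a u → ¬ R a v → u ∈ U := by
      intro g u v hg hu hv
      by_cases hge : g = e
      · subst hge
        rcases he.left_eq_or_eq hg with h | h <;> rcases he.right_eq_or_eq hg with h' | h'
        · exact absurd (h.trans h'.symm) (hne he)
        · exact Or.inl h.symm
        · exact Or.inr (Or.inl h'.symm)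
        · exact absurd (h.trans h'.symm) (hne he)
      · have hgD₀ := (hmem g).2 ⟨hg.edge_mem, hge⟩
        by_cases hgD : g ∈ D
        · exact Or.inr (Or.inr ⟨g, hgD, ((hlink hgD₀).2 hg).inc_left⟩)
        · exact absurd (hu.tail ⟨g, hgD₀, hgD, (hlink hgD₀).2 hg⟩) hv
    have hcz := hH.1.1.2 c hcV z hzV
    by_cases hex : ∃ t ∈ U, R a t
    · obtain ⟨t, htU, hat⟩ := hex
      have hct : c ≠ t := fun h => hcU (h ▸ htU)
      have hzt : z ≠ t := fun h => hz (h ▸ hat)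
      have htV : t ∈ V(H) := by
        rcases htU with rfl | rfl | ⟨g, hg, s, hs⟩
        · exact he.left_mem
        · exact he.right_mem
        · exact ((hlink (hD.1 hg)).1 hs).left_mem
      refine hH.1.2 t ⟨htV, c, ⟨hcV, hct⟩, z, ⟨hzV, hzt⟩, hcz, fun hsame => ?_⟩
      have : ∀ v, Relation.ReflTransGen (H.deleteVerts {t}).Adj c v → R a v := by
        intro v hv
        induction hv with
        | refl => exact hac
        | @tail u v _ huv ih =>
          obtain ⟨g, hg⟩ := huv
          rw [deleteVerts_isLink] at hg
          by_contra hv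
          have := hout g u v hg.1 ih hv
          exact hg.2.1 (huniq u this t htU ih hat)
      exact hz (this z hsame.2.2)
    · have : ∀ v, Relation.ReflTransGen H.Adj c v → R a v := by
        intro v hv
        induction hv with
        | refl => exact hac
        | @tail u v _ huv ih =>
          obtain ⟨g, hg⟩ := huv
          by_contra hv
          exact hex ⟨u, hout g u v hg ih hv, ih⟩
      exact hz (this z hcz.2.2)
  refine ⟨ncard_le_of_reachable (G := G.deleteEdges {e}) (x := x) D₀ _ fun v hv => ?_, hjoin⟩
  -- With nothing known the only terminals are `x` and `y`, so the joining property gives a detour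
  -- around `e`.
  have hxy : Relation.ReflTransGen
      (fun a b => ∃ f ∈ D₀, (G.deleteEdges {e}).IsLink f a b) x y := by
    have hD₀ne : ∅ ⊂ D₀ := by
      obtain ⟨f, hf, hfe⟩ := hH.2.exists_ne e
      exact Finset.empty_ssubset.2 ⟨f, (hmem f).2 ⟨hf, hfe⟩⟩
    obtain ⟨u, hu, v, hv, huv, hR⟩ := hjoin ∅ hD₀ne
    simp only [terminals, Finset.notMem_empty, false_and, exists_false, or_false,
      Set.mem_ofPred_eq] at hu hv
    have hmono : ∀ {u v}, Relation.ReflTransGen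
        (fun a b => ∃ f ∈ D₀, f ∉ (∅ : Finset β) ∧ (G.deleteEdges {e}).IsLink f a b) u v →
        Relation.ReflTransGen (fun a b => ∃ f ∈ D₀, (G.deleteEdges {e}).IsLink f a b) u v :=
      fun h => Relation.ReflTransGen.mono (fun a b ⟨f, h1, _, h3⟩ => ⟨f, h1, h3⟩) _ _ h
    rcases hu with rfl | rfl <;> rcases hv with rfl | rfl
    · exact absurd rfl huv
    · exact hmono hR
    · exact hmono (hsymm ∅ hR)
    · exact absurd rfl huv
  have hvV : v ∈ V(H) := by
    rcases hv with rfl | rfl | ⟨g, hg, s, hs⟩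
    · exact he.left_mem
    · exact he.right_mem
    · exact ((hlink hg).1 hs).left_mem
  have hreach := (hH.1.1.2 x he.left_mem v hvV).2.2
  clear hv hvV
  induction hreach with
  | refl => exact .refl
  | @tail u v _ huv ih =>
    obtain ⟨g, hg⟩ := huv
    by_cases hge : g = e
    · subst hge
      rcases he.eq_and_eq_or_eq_and_eq hg with ⟨rfl, rfl⟩ | ⟨rfl, rfl⟩
      · exact hxy
      · exact .refl
    · have hgD₀ := (hmem g).2 ⟨hg.edge_mem, hge⟩
      exact ih.tail ⟨g, hgD₀, (hlink hgD₀).2 hg⟩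

end Graph

/-! ### Light cuts from maxmaxflow, and the generating function. -/

namespace Graph

variable {α β : Type*} {G : Graph α β} {x y : α}

lemma cutWeight_eq_sum (w : β → ℝ≥0) (S : Set α) (E : Finset β)
    (hE : (E : Set β) = G.cutEdges S) : G.cutWeight w S = ((∑ f ∈ E, w f : ℝ≥0) : ℝ≥0∞) := by
  rw [cutWeight, ← hE, ENNReal.ofNNReal_finsetSum]
  exact Finset.tsum_subtype' E fun f => (w f : ℝ≥0∞)

lemma cutEdges_subset (S : Set α) : G.cutEdges S ⊆ E(G) := fun _ ⟨_, _, _, _, h⟩ => h.edge_mem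

lemma exists_cutWeight_eq_maxFlow (hV : V(G).Finite) (w : β → ℝ≥0) {u v : α} (hu : u ∈ V(G))
    (huv : u ≠ v) : ∃ S : Set α, u ∈ S ∧ v ∉ S ∧ G.cutWeight w S = G.maxFlow w u v := by
  have hfin : Finite {S : Set α // S ⊆ V(G) ∧ u ∈ S ∧ v ∉ S} :=
    (hV.finite_subsets.subset fun S hS => hS.1).to_subtype
  have hne : Nonempty {S : Set α // S ⊆ V(G) ∧ u ∈ S ∧ v ∉ S} :=
    ⟨{u}, by simpa using hu, rfl, huv.symm⟩
  obtain ⟨S, hS⟩ := exists_eq_ciInf_of_finite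
    (f := fun S : {S : Set α // S ⊆ V(G) ∧ u ∈ S ∧ v ∉ S} => G.cutWeight w S)
  exact ⟨S, S.2.2.1, S.2.2.2, hS⟩

lemma maxFlow_le_maxmaxflow (w : β → ℝ≥0) {u v : α} (hu : u ∈ V(G)) (hv : v ∈ V(G))
    (huv : u ≠ v) : G.maxFlow w u v ≤ G.maxmaxflow w :=
  le_iSup₂_of_le u hu <| le_iSup₂_of_le v hv <| le_iSup_of_le huv le_rfl

lemma maxmaxflow_ne_top (hV : V(G).Finite) (hE : E(G).Finite) (w : β → ℝ≥0) :
    G.maxmaxflow w ≠ ⊤ := by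
  classical
  refine ne_top_of_le_ne_top (b := ((∑ f ∈ hE.toFinset, w f : ℝ≥0) : ℝ≥0∞)) ENNReal.coe_ne_top ?_
  refine iSup₂_le fun u hu => iSup₂_le fun v hv => iSup_le fun huv => ?_
  obtain ⟨S, -, -, hS⟩ := exists_cutWeight_eq_maxFlow hV w hu huv
  rw [← hS, cutWeight_eq_sum w S (hE.subset (cutEdges_subset S)).toFinset (by simp)]
  exact ENNReal.coe_le_coe.2 (Finset.sum_le_sum_of_subset
    (Set.Finite.toFinset_mono (cutEdges_subset S)))

open Classical in
/-- If `t ≥ 2 Λ / log 2`, any two vertices are separated by a cut that is light for the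
weights `w / t`. -/
lemma exists_cut_prod_le_two (hV : V(G).Finite) (hE : E(G).Finite) (w : β → ℝ≥0) {t : ℝ≥0}
    (ht : t ≠ 0) (hΛ : 2 * G.maxmaxflow w / ENNReal.ofReal (Real.log 2) ≤ t) {u v : α}
    (hu : u ∈ V(G)) (hv : v ∈ V(G)) (huv : u ≠ v) :
    ∃ S : Set α, u ∈ S ∧ v ∉ S ∧
      ∏ f ∈ hE.toFinset with f ∈ G.cutEdges S, (1 + 2 * (w f / t)) ≤ 2 := by
  obtain ⟨S, huS, hvS, hS⟩ := exists_cutWeight_eq_maxFlow hV w hu huv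
  refine ⟨S, huS, hvS, ?_⟩
  set F := hE.toFinset.filter (· ∈ G.cutEdges S) with hF
  have hlog : 0 < Real.log 2 := Real.log_pos one_lt_two
  have hw : G.cutWeight w S ≤ G.maxmaxflow w := hS ▸ maxFlow_le_maxmaxflow w hu hv huv
  rw [cutWeight_eq_sum w S F (by
    ext f
    simpa [hF] using fun h => cutEdges_subset S h)] at hw
  have h1 : (2 : ℝ≥0∞) * ((∑ f ∈ F, w f : ℝ≥0) : ℝ≥0∞) ≤ t * ENNReal.ofReal (Real.log 2) := by
    refine (mul_le_mul_right hw 2).trans ?_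
    exact (ENNReal.div_le_iff (by simpa using hlog) ENNReal.ofReal_ne_top).1 hΛ
  have h2 : 2 * ∑ f ∈ F, w f ≤ t * (Real.log 2).toNNReal := by
    rw [ENNReal.ofReal] at h1
    exact_mod_cast h1
  have h3 : 2 * ∑ f ∈ F, (w f : ℝ) ≤ t * Real.log 2 := by
    have := NNReal.coe_le_coe.2 h2
    push_cast at this
    rwa [Real.coe_toNNReal _ hlog.le] at this
  have ht' : (0 : ℝ) < t := NNReal.coe_pos.2 (pos_iff_ne_zero.2 ht)
  rw [← NNReal.coe_le_coe]
  push_cast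
  calc ∏ f ∈ F, (1 + 2 * ((w f : ℝ) / t)) ≤ Real.exp (∑ f ∈ F, 2 * ((w f : ℝ) / t)) :=
        Real.prod_one_add_le_exp_sum F fun f => by positivity
    _ ≤ Real.exp (Real.log 2) := by
        rw [Real.exp_le_exp, ← Finset.mul_sum, ← Finset.sum_div, ← mul_div_assoc, div_le_iff₀ ht',
          mul_comm (Real.log 2)]
        exact h3
    _ = 2 := Real.exp_log two_pos

lemma weight_eq_mul_prod {H : Graph α β} (w : β → ℝ≥0) {e : β} (he : e ∈ E(H)) {D : Finset β}
    (hD : (D : Set β) = E(H) \ {e}) : H.weight w = w e * ∏ f ∈ D, w f := by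
  classical
  have heD : e ∉ D := fun h => by
    have : e ∈ (D : Set β) := h
    simp [hD] at this
  have : E(H) = ((insert e D : Finset β) : Set β) := by
    rw [Finset.coe_insert, hD, Set.insert_sdiff_singleton, Set.insert_eq_of_mem he]
  rw [weight, this, finprod_mem_coe_finset, Finset.prod_insert heD]

/-- Every vertex of a 2-connected graph is the end of an edge. -/
lemma IsTwoConnected.mem_vertexSet_iff {H : Graph α β} (hH : H.IsTwoConnected) {v : α} :
    v ∈ V(H) ↔ ∃ f, H.Inc f v := by
  refine ⟨fun hv => ?_, fun ⟨f, hf⟩ => hf.vertex_mem⟩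
  obtain ⟨f, hf, -⟩ := hH.2
  obtain ⟨a, b, hab⟩ := H.exists_isLink_of_mem_edgeSet hf
  obtain rfl | hva := eq_or_ne v a
  · exact ⟨f, hab.inc_left⟩
  · rcases (hH.1.1.2 v hv a hab.left_mem).2.2.cases_head with h | ⟨u, ⟨g, hg⟩, -⟩
    · exact absurd h hva
    · exact ⟨g, hg.inc_left⟩

/-- Having no isolated vertices, such subgraphs are counted faithfully by their edge sets. -/
lemma IsTwoConnected.eq_of_edgeSet_eq {H H' : Graph α β} (hH : H.IsTwoConnected)
    (hH' : H'.IsTwoConnected) (hHG : H ≤ G) (hHG' : H' ≤ G) (h : E(H) = E(H')) : H = H' := by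
  have hl : ∀ f a b, H.IsLink f a b ↔ H'.IsLink f a b := fun f a b => by
    by_cases hf : f ∈ E(H)
    · rw [hHG.isLink_iff hf, hHG'.isLink_iff (h ▸ hf)]
    · exact ⟨fun hab => absurd hab.edge_mem hf, fun hab => absurd (h ▸ hab.edge_mem) hf⟩
  refine Graph.ext ?_ hl
  ext v
  rw [hH.mem_vertexSet_iff, hH'.mem_vertexSet_iff]
  simp only [Inc, hl]

/-- The bound on the generating function of the 2-connected subgraphs containing `e`. -/
theorem tsum_zpow_mul_twoConnectedSum_le [G.Loopless] (hV : V(G).Finite) (hE : E(G).Finite)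
    (w : β → ℝ≥0) {e : β} (he : e ∈ E(G)) {t : ℝ≥0} (ht : t ≠ 0)
    (hΛ : 2 * (G.deleteEdges {e}).maxmaxflow w / ENNReal.ofReal (Real.log 2) ≤ t) :
    ∑' m : ℕ, (t : ℝ≥0∞) ^ (1 - (m : ℤ)) * G.twoConnectedSum w e m ≤ w e := by
  classical
  obtain ⟨x, y, hxy⟩ := G.exists_isLink_of_mem_edgeSet he
  set K := G.deleteEdges {e} with hK
  have hKV : V(K).Finite := hV
  have hKE : E(K).Finite := hE.subset deleteEdges_le.edgeSet_mono
  have hbound := sum_isBlockPath_le_one (G := K) (x := x) (y := y) hKV hxy.left_mem hxy.right_mem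
    hKE.toFinset (fun f => w f / t)
    fun u hu v hv huv => exists_cut_prod_le_two hKV hKE w ht hΛ hu hv huv
  set P := hKE.toFinset.powerset.filter (K.IsBlockPath x y) with hP
  let X := Σ m : ℕ, {H : Graph α β // H ≤ G ∧ H.IsTwoConnected ∧ e ∈ E(H) ∧ E(H).encard = m}
  have hfin : ∀ X : X, (E(X.2.1) \ {e}).Finite := fun X =>
    (hE.subset X.2.2.1.edgeSet_mono).subset Set.sdiff_subset
  let D : X → Finset β := fun X => (hfin X).toFinset
  have hD : ∀ X, (D X : Set β) = E(X.2.1) \ {e} := fun X => (hfin X).coe_toFinset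
  have hDP : ∀ X, D X ∈ P := fun X => by
    obtain ⟨hHG, hH, heH, -⟩ := X.2.2
    rw [hP, Finset.mem_filter, Finset.mem_powerset]
    refine ⟨fun f hf => ?_, hH.isBlockPath hHG ((hHG.isLink_iff heH).2 hxy) (hD X)⟩
    have hf' : f ∈ E(X.2.1) \ {e} := hD X ▸ hf
    simp only [Set.Finite.mem_toFinset, hK, edgeSet_deleteEdges]
    exact ⟨hHG.edgeSet_mono hf'.1, hf'.2⟩
  have hcard : ∀ X : X, X.1 = (D X).card + 1 := fun X => by
    have h := X.2.2.2.2.2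
    rw [← Set.encard_sdiff_singleton_add_one X.2.2.2.2.1, ← hD X, Set.encard_coe_eq_coe_finsetCard]
      at h
    exact_mod_cast h.symm
  have hinj : Function.Injective fun X => (⟨D X, hDP X⟩ : P) := by
    intro X Y hXY
    have hDXY : D X = D Y := congrArg Subtype.val hXY
    have hm : X.1 = Y.1 := by rw [hcard, hcard, hDXY]
    have hEq : E(X.2.1) = E(Y.2.1) := by
      rw [← Set.insert_eq_of_mem X.2.2.2.2.1, ← Set.insert_eq_of_mem Y.2.2.2.2.1,
        ← Set.insert_sdiff_singleton, ← hD X, hDXY, hD Y, Set.insert_sdiff_singleton]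
    have hH : X.2.1 = Y.2.1 :=
      X.2.2.2.1.eq_of_edgeSet_eq Y.2.2.2.1 X.2.2.1 Y.2.2.1 hEq
    obtain ⟨m, H, hH₁⟩ := X
    obtain ⟨m', H', hH₂⟩ := Y
    obtain rfl : m = m' := hm
    obtain rfl : H = H' := hH
    rfl
  have hterm : ∀ X : X, (t : ℝ≥0∞) ^ (1 - (X.1 : ℤ)) * (X.2.1.weight w : ℝ≥0∞) =
      ((w e * ∏ f ∈ D X, w f / t : ℝ≥0) : ℝ≥0∞) := fun X => by
    rw [weight_eq_mul_prod w X.2.2.2.2.1 (hD X), ← ENNReal.coe_zpow ht, ← ENNReal.coe_mul,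
      ENNReal.coe_inj, hcard X, Finset.prod_div_distrib, Finset.prod_const]
    have : (1 - (((D X).card + 1 : ℕ) : ℤ)) = -((D X).card : ℤ) := by push_cast; ring
    rw [this, zpow_neg, zpow_natCast]
    field_simp
  calc ∑' m : ℕ, (t : ℝ≥0∞) ^ (1 - (m : ℤ)) * G.twoConnectedSum w e m
      = ∑' X : X, (t : ℝ≥0∞) ^ (1 - (X.1 : ℤ)) * (X.2.1.weight w : ℝ≥0∞) := by
        simp only [twoConnectedSum, ← ENNReal.tsum_mul_left]
        exact (ENNReal.tsum_sigma' fun X : X =>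
          (t : ℝ≥0∞) ^ (1 - (X.1 : ℤ)) * (X.2.1.weight w : ℝ≥0∞)).symm
    _ = ∑' X : X, (fun C : P => ((w e * ∏ f ∈ C.1, w f / t : ℝ≥0) : ℝ≥0∞)) ⟨D X, hDP X⟩ :=
        tsum_congr hterm
    _ ≤ ∑' C : P, ((w e * ∏ f ∈ C.1, w f / t : ℝ≥0) : ℝ≥0∞) :=
        ENNReal.tsum_comp_le_tsum_of_injective hinj _
    _ = ((w e * ∑ C ∈ P, ∏ f ∈ C, w f / t : ℝ≥0) : ℝ≥0∞) := by
        rw [Finset.mul_sum, ENNReal.ofNNReal_finsetSum]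
        exact Finset.tsum_subtype P fun C => ((w e * ∏ f ∈ C, w f / t : ℝ≥0) : ℝ≥0∞)
    _ ≤ w e := ENNReal.coe_le_coe.2 (mul_le_of_le_one_right' hbound)

lemma twoConnectedSum_one (w : β → ℝ≥0) (e : β) : G.twoConnectedSum w e 1 = 0 := by
  rw [twoConnectedSum, ENNReal.tsum_eq_zero]
  rintro ⟨H, -, hH, -, h1⟩
  obtain ⟨f, hf⟩ := Set.encard_eq_one.1 (by simpa using h1)
  exact absurd hH.2 (by simp [hf])

lemma twoConnectedSum_eq_zero_of_weight_eq_zero (hE : E(G).Finite) {w : β → ℝ≥0} {e : β}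
    (hw : w e = 0) (m : ℕ) : G.twoConnectedSum w e m = 0 := by
  rw [twoConnectedSum, ENNReal.tsum_eq_zero]
  rintro ⟨H, hHG, -, he, -⟩
  have hfin : (E(H) \ {e}).Finite := (hE.subset hHG.edgeSet_mono).subset Set.sdiff_subset
  simp [weight_eq_mul_prod w he hfin.coe_toFinset, hw]

/-- If `Λ(G - e) = 0`, then no 2-connected subgraph containing `e` has positive weight. -/
lemma zpow_mul_twoConnectedSum_eq_zero [G.Loopless] (hV : V(G).Finite) (hE : E(G).Finite)
    (w : β → ℝ≥0) {e : β} (he : e ∈ E(G)) (hΛ : (G.deleteEdges {e}).maxmaxflow w = 0) (m : ℕ) :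
    (0 : ℝ≥0∞) ^ (1 - (m : ℤ)) * G.twoConnectedSum w e m = 0 := by
  rcases m with _ | _ | m
  · simp
  · simp [twoConnectedSum_one]
  · suffices h : G.twoConnectedSum w e (m + 2) = 0 by simp [h]
    -- When `Λ = 0` every positive `t` is admissible, and the single term of index `m + 2` already
    -- forces the sum to vanish as `t → 0`.
    have hb : ∀ t : ℝ≥0, t ≠ 0 → t ≤ 1 → G.twoConnectedSum w e (m + 2) ≤ w e * t := by
      intro t ht ht1
      have ht0 : (t : ℝ≥0∞) ≠ 0 := by simpa using ht
      have h := (ENNReal.le_tsum (m + 2)).trans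
        (tsum_zpow_mul_twoConnectedSum_le hV hE w he ht (by simp [hΛ]))
      have hz : (1 - ((m + 2 : ℕ) : ℤ)) = -((m + 1 : ℕ) : ℤ) := by push_cast; ring
      rw [hz, ENNReal.zpow_neg, zpow_natCast, mul_comm, ← div_eq_mul_inv, ENNReal.div_le_iff
        (pow_ne_zero _ ht0) (ENNReal.pow_ne_top ENNReal.coe_ne_top)] at h
      refine h.trans (mul_le_mul_right ?_ _)
      rw [pow_succ]
      exact mul_le_of_le_one_left' (pow_le_one₀ zero_le (by exact_mod_cast ht1))
    have hne : G.twoConnectedSum w e (m + 2) ≠ ⊤ :=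
      ne_top_of_le_ne_top (by simp) (hb 1 one_ne_zero le_rfl)
    lift G.twoConnectedSum w e (m + 2) to ℝ≥0 using hne with b
    norm_cast at hb ⊢
    by_contra hb0
    have hbpos : 0 < b := pos_iff_ne_zero.2 hb0
    have hwpos : 0 < w e + b := add_pos_of_nonneg_of_pos zero_le hbpos
    -- This `t` makes `w e * t ≤ b / 2`, which contradicts `b ≤ w e * t`.
    have := hb (b / (2 * (w e + b))) (by positivity)
      (div_le_one_of_le₀ (by
        calc b ≤ w e + b := le_add_self
          _ ≤ 2 * (w e + b) := le_mul_of_one_le_left' one_le_two) zero_le)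
    rw [← mul_div_assoc, le_div_iff₀ (by positivity)] at this
    rw [← NNReal.coe_le_coe] at this
    push_cast at this
    have hb' : (0 : ℝ) < b := hbpos
    have hw' : (0 : ℝ) ≤ w e := (w e).2
    nlinarith

end Graph

theorem corollary7p5 {α β : Type*} (G : Graph α β) [G.Loopless]
    (hV : V(G).Finite) (hE : E(G).Finite) (w : β → ℝ≥0) (e : β) (he : e ∈ E(G)) :
    (∑' m : ℕ, (2 * (G.deleteEdges {e}).maxmaxflow w / ENNReal.ofReal (Real.log 2)) ^ (1 - (m : ℤ))
        * G.twoConnectedSum w e m ≤ (w e : ℝ≥0∞)) ∧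
    ((w e : ℝ≥0∞) ≤ 2 * (G.deleteEdges {e}).maxmaxflow w / ENNReal.ofReal (Real.log 2) →
      ∑' m : ℕ, (2 * (G.deleteEdges {e}).maxmaxflow w / ENNReal.ofReal (Real.log 2)) ^ (-(m : ℤ))
        * G.twoConnectedSum w e m ≤ 1) := by
  have hΛ : (G.deleteEdges {e}).maxmaxflow w ≠ ⊤ :=
    Graph.maxmaxflow_ne_top (G := G.deleteEdges {e}) hV
      (hE.subset Graph.deleteEdges_le.edgeSet_mono) w
  by_cases h0 : (G.deleteEdges {e}).maxmaxflow w = 0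
  · simp only [h0, mul_zero, ENNReal.zero_div]
    refine ⟨?_, fun hw => ?_⟩
    · simp [Graph.zpow_mul_twoConnectedSum_eq_zero hV hE w he h0]
    · have hwe : w e = 0 := by simpa using hw
      simp [Graph.twoConnectedSum_eq_zero_of_weight_eq_zero hE hwe]
  · have hlog : ENNReal.ofReal (Real.log 2) ≠ 0 := by
      simpa using Real.log_pos one_lt_two
    obtain ⟨t, ht⟩ : ∃ t : ℝ≥0, (t : ℝ≥0∞) =
        2 * (G.deleteEdges {e}).maxmaxflow w / ENNReal.ofReal (Real.log 2) :=
      ⟨_, ENNReal.coe_toNNReal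
        (ENNReal.div_ne_top (ENNReal.mul_ne_top ENNReal.ofNat_ne_top hΛ) hlog)⟩
    have ht0 : (t : ℝ≥0∞) ≠ 0 := by
      rw [ht]
      exact ENNReal.div_ne_zero.2 ⟨mul_ne_zero two_ne_zero h0, ENNReal.ofReal_ne_top⟩
    have h1 := Graph.tsum_zpow_mul_twoConnectedSum_le hV hE w he (by simpa using ht0) ht.ge
    rw [← ht]
    refine ⟨h1, fun hw => ?_⟩
    have hshift : ∀ m : ℕ, (t : ℝ≥0∞) ^ (-(m : ℤ)) * G.twoConnectedSum w e m =
        (t : ℝ≥0∞)⁻¹ * ((t : ℝ≥0∞) ^ (1 - (m : ℤ)) * G.twoConnectedSum w e m) := fun m => by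
      rw [← mul_assoc, ← zpow_neg_one, ← ENNReal.zpow_add ht0 ENNReal.coe_ne_top]
      congr 2
      ring
    simp only [hshift, ENNReal.tsum_mul_left]
    calc (t : ℝ≥0∞)⁻¹ * ∑' m : ℕ, (t : ℝ≥0∞) ^ (1 - (m : ℤ)) * G.twoConnectedSum w e m
        ≤ (t : ℝ≥0∞)⁻¹ * t := mul_le_mul_right (h1.trans hw) _
      _ = 1 := ENNReal.inv_mul_cancel ht0 ENNReal.coe_ne_top
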